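/- For a set $S\subset\mathbb{R}^d$ let $\mathrm{G}(S)=\#(S\cap\mathbb{Z}^d)$. A lattice polytope $P\subset\mathbb{R}^d$ is the convex hull of finitely many points of $\mathbb{Z}^d$ with $\dim P=d$; its $h^\star$-polynomial is the polynomial $f\in\mathbb{Z}[z]$ determined by $$\sum_{k\ge 0}\mathrm{G}(kP)\,z^k=\frac{f(z)}{(1-z)^{d+1}}.$$ Let $a_1,a_2\ge 0$ be integers such that $$a_1\le 7\ \text{ if } a_2=1,\qquad a_1\le 3a_2+3\ \text{ if } a_2\ge 2$$ (no condition is imposed if $a_2=0$). Then there are a dimension $d$ and a $d$-dimensional lattice polytope $P\subset\mathbb{R}^d$ whose $h^\star$-polynomial is $1+a_1z+a_2z^2$. -/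

import Mathlib

open scoped Pointwise

/-- The real vector with the given integral coordinates. -/
def intVec {d : ℕ} (v : Fin d → ℤ) : Fin d → ℝ := fun i => (v i : ℝ)

/-- `P` is a `d`-dimensional convex lattice polytope in `ℝ^d` with respect to the standard lattice
`ℤ^d`: the convex hull of finitely many integral points, whose affine hull is all of `ℝ^d`
(in particular `P` is non-empty). -/
def IsLatticePolytope {d : ℕ} (P : Set (Fin d → ℝ)) : Prop :=
  (∃ V : Finset (Fin d → ℤ), P = convexHull ℝ (intVec '' (V : Set (Fin d → ℤ)))) ∧
    affineSpan ℝ P = ⊤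

/-- The lattice point enumerator: the number of integral points of `S`. -/
noncomputable def latticePointCount {d : ℕ} (S : Set (Fin d → ℝ)) : ℕ :=
  {v : Fin d → ℤ | intVec v ∈ S}.ncard

/-- The Ehrhart series, whose `k`-th coefficient is the number of integral points of the dilate
`k P`. For non-empty `P` the dilate `0 P` is `{0}`, so that the constant coefficient is `1`. -/
noncomputable def ehrhartSeries {d : ℕ} (P : Set (Fin d → ℝ)) : PowerSeries ℤ :=
  PowerSeries.mk fun k => (latticePointCount ((k : ℝ) • P) : ℤ)

/-- `f` is the `h*`-polynomial of `P`, the numerator of the Ehrhart series over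
`(1 - z)^(d + 1)`. As `(1 - z)^(d + 1)` is invertible in the ring of power series, this says that
the Ehrhart series equals `f(z) / (1 - z)^(d + 1)`, and it determines `f`. -/
def IsHStarPolynomial {d : ℕ} (P : Set (Fin d → ℝ)) (f : Polynomial ℤ) : Prop :=
  ehrhartSeries P * (1 - PowerSeries.X) ^ (d + 1) = (f : PowerSeries ℤ)

/-!
For `a₁ ≤ a₂` a three-dimensional polytope without interior lattice points does the job, for
`a₁ > a₂` a polygon does. In both cases every lattice point of the `k`-th dilate is counted by
fibring over a coordinate projection.

* The polytope with vertices `0, (0, 0, -a), e₁, e₂, (1, 1, K)`, where `a ≤ K`, lies over the unit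
  square, and its boundary is linear over the pieces of unimodular triangulations of the square.
  All fibres over lattice points of the dilates therefore have integral ends, and summing their
  lengths gives `K C(k + 1, 3) + a C(k + 2, 3) + (k + 1)²`, that is, the numerator
  `1 + a z + (K - 1) z²` (`six_mul_latticePointCount_square`, `isHStarPolynomial_square`).
  With `a = 0` these are Reeve's tetrahedra.
* The polygon with vertices `(0, 0), (p, 0), (m N, 1), (0, N + 1)`, where `p ≤ m (N + 1)`, has
  integral horizontal widths at all integral heights, in all dilates
  (`two_mul_latticePointCount_polygon`). For `N = 1` its numerator is `1 + (p + m) z + (m - 1) z²`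
  with `0 ≤ p ≤ 2 m`, which covers `a₂ + 1 ≤ a₁ ≤ 3 a₂ + 3`. The remaining cases `a₂ = 0` and
  `(a₁, a₂) = (7, 1)` are triangles with `N = 0` and `N = 2`.

A dilate `k P` is described by nonnegative vertex weights of total `k`
(`intVec_mem_smul_latticeHull`); the inequalities for a fibre follow from such weights, and
conversely it suffices to give weights for the two ends of a fibre, by convexity. The count is
turned into a numerator by `isHStarPolynomial_of_count`.
-/

/-! ### Lattice points in dilates of a convex hull -/

/-- The convex hull in `ℝ^d` of a finite family of integral points. -/
def latticeHull {ι : Type*} {d : ℕ} (w : ι → Fin d → ℤ) : Set (Fin d → ℝ) :=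
  convexHull ℝ (Set.range fun i => intVec (w i))

theorem mem_convexHull_range_iff {ι E : Type*} [Fintype ι] [AddCommGroup E] [Module ℝ E]
    (w : ι → E) (x : E) :
    x ∈ convexHull ℝ (Set.range w) ↔
      ∃ c : ι → ℝ, (∀ i, 0 ≤ c i) ∧ ∑ i, c i = 1 ∧ ∑ i, c i • w i = x := by
  classical
  constructor
  · intro hx
    let f : (ι → ℝ) →ₗ[ℝ] E := Fintype.linearCombination ℝ w
    have h : Set.range w = f '' Set.range fun i : ι => Pi.single i (1 : ℝ) := by
      rw [← Set.range_comp]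
      congr 1
      ext i
      simp [f, Fintype.linearCombination_apply_single]
    rw [h, ← f.image_convexHull, convexHull_rangle_single_eq_stdSimplex] at hx
    obtain ⟨c, hc, rfl⟩ := hx
    exact ⟨c, hc.1, hc.2, by simp [f, Fintype.linearCombination_apply]⟩
  · rintro ⟨c, hc, hs, rfl⟩
    exact (convex_convexHull ℝ _).sum_mem (fun i _ => hc i) hs
      fun i _ => subset_convexHull ℝ _ ⟨i, rfl⟩

/-- Points of the dilate `k P` are combinations of the vertices whose weights add up to `k`;
in this form `k = 0` needs no separate treatment. -/
theorem intVec_mem_smul_latticeHull {ι : Type*} [Fintype ι] [Nonempty ι] {d : ℕ}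
    (w : ι → Fin d → ℤ) (k : ℕ) (v : Fin d → ℤ) :
    intVec v ∈ (k : ℝ) • latticeHull w ↔
      ∃ c : ι → ℝ, (∀ i, 0 ≤ c i) ∧ ∑ i, c i = k ∧ ∀ j, ∑ i, c i * w i j = v j := by
  constructor
  · intro h
    obtain ⟨x, hx, hxv⟩ := Set.mem_smul_set.1 h
    obtain ⟨c, hc, hs, rfl⟩ := (mem_convexHull_range_iff _ _).1 hx
    refine ⟨fun i => k * c i, fun i => mul_nonneg k.cast_nonneg (hc i), ?_, fun j => ?_⟩
    · rw [← Finset.mul_sum, hs, mul_one]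
    · have := congrFun hxv j
      simpa [intVec, Finset.mul_sum, mul_assoc] using this
  · rintro ⟨c, hc, hs, hv⟩
    rcases Nat.eq_zero_or_pos k with rfl | hk
    · have hc0 : ∀ i, c i = 0 := fun i =>
        (Finset.sum_eq_zero_iff_of_nonneg fun i _ => hc i).1 (by simpa using hs) i
          (Finset.mem_univ i)
      have hv0 : intVec v = 0 := by
        ext j
        simpa [hc0, intVec] using (hv j).symm
      rw [hv0]
      inhabit ι
      exact Set.mem_smul_set.2 ⟨intVec (w default), subset_convexHull ℝ _ ⟨default, rfl⟩, by simp⟩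
    · have hk' : (k : ℝ) ≠ 0 := by positivity
      refine Set.mem_smul_set.2 ⟨(k : ℝ)⁻¹ • intVec v, ?_, by simp [hk']⟩
      refine (mem_convexHull_range_iff _ _).2
        ⟨fun i => (k : ℝ)⁻¹ * c i, fun i => mul_nonneg (by positivity) (hc i), ?_, ?_⟩
      · rw [← Finset.mul_sum, hs, inv_mul_cancel₀ hk']
      · ext j
        simp [intVec, ← hv j, Finset.mul_sum, mul_assoc]

theorem isLatticePolytope_latticeHull {ι : Type*} [Fintype ι] {d : ℕ} (w : ι → Fin d → ℤ)
    (i₀ : ι) (h₀ : w i₀ = 0)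
    (hw : ∀ j, Pi.single j (1 : ℝ) ∈ Submodule.span ℝ (Set.range fun i => intVec (w i))) :
    IsLatticePolytope (latticeHull w) := by
  classical
  refine ⟨⟨Finset.univ.image w, ?_⟩, ?_⟩
  · simp [latticeHull, ← Set.range_comp, Function.comp_def]
  · have h : Submodule.span ℝ (Set.range fun i => intVec (w i)) = ⊤ := by
      rw [eq_top_iff, ← (Pi.basisFun ℝ (Fin d)).span_eq, Submodule.span_le]
      rintro _ ⟨j, rfl⟩
      simpa using hw j
    have h0 : (0 : Fin d → ℝ) ∈ Set.range fun i => intVec (w i) :=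
      ⟨i₀, by ext j; simp [h₀, intVec]⟩
    rw [latticeHull, affineSpan_convexHull]
    apply SetLike.coe_injective
    rw [← Set.insert_eq_of_mem h0, affineSpan_insert_zero, h]
    simp

/-- A convex set meets every line in the direction of a coordinate axis in an interval. -/
theorem Convex.mem_of_coordinate_between {d : ℕ} {Q : Set (Fin d → ℝ)} (hQ : Convex ℝ Q)
    {l u v : Fin d → ℤ} (hl : intVec l ∈ Q) (hu : intVec u ∈ Q) (i : Fin d)
    (h₁ : l i ≤ v i) (h₂ : v i ≤ u i) (h : ∀ j, j ≠ i → l j = v j ∧ u j = v j) :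
    intVec v ∈ Q := by
  rcases eq_or_lt_of_le (h₁.trans h₂) with he | hlt
  · have : l = v := by
      ext j
      by_cases hj : j = i
      · subst hj; omega
      · exact (h j hj).1
    rwa [← this]
  · have h₁' : (l i : ℝ) ≤ v i := by exact_mod_cast h₁
    have h₂' : (v i : ℝ) ≤ u i := by exact_mod_cast h₂
    have hlt' : (0 : ℝ) < u i - l i := by
      have : (l i : ℝ) < u i := by exact_mod_cast hlt
      linarith
    have key := hQ hl hu (a := (u i - v i) / (u i - l i)) (b := (v i - l i) / (u i - l i))
      (div_nonneg (by linarith) hlt'.le) (div_nonneg (by linarith) hlt'.le) (by field_simp; ring)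
    convert key using 1
    ext j
    by_cases hj : j = i
    · subst hj
      simp only [intVec, Pi.add_apply, Pi.smul_apply, smul_eq_mul]
      field_simp
      ring
    · simp only [intVec, Pi.add_apply, Pi.smul_apply, smul_eq_mul, (h j hj).1, (h j hj).2]
      field_simp
      ring

theorem ncard_eq_sum_fibres {α β : Type*} (S : Set β) (B : Finset α) (lo up : α → ℤ)
    (e : α → ℤ → β) (he : ∀ a a' z z', e a z = e a' z' → a = a' ∧ z = z')
    (hS : ∀ v, v ∈ S ↔ ∃ a ∈ B, ∃ z, lo a ≤ z ∧ z ≤ up a ∧ e a z = v)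
    (hlu : ∀ a ∈ B, lo a ≤ up a) :
    (S.ncard : ℤ) = ∑ a ∈ B, (up a - lo a + 1) := by
  classical
  have hS' : S = ↑((B.sigma fun a => Finset.Icc (lo a) (up a)).image fun q => e q.1 q.2) := by
    ext v
    rw [hS]
    simp only [Finset.coe_image, Set.mem_image, Finset.mem_coe, Finset.mem_sigma, Finset.mem_Icc,
      Sigma.exists]
    constructor
    · rintro ⟨a, ha, z, h1, h2, h3⟩
      exact ⟨a, z, ⟨ha, h1, h2⟩, h3⟩
    · rintro ⟨a, z, ⟨ha, h1, h2⟩, h3⟩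
      exact ⟨a, ha, z, h1, h2, h3⟩
  rw [hS', Set.ncard_coe_finset, Finset.card_image_of_injective, Finset.card_sigma]
  · push_cast
    refine Finset.sum_congr rfl fun a ha => ?_
    rw [Int.card_Icc, Int.toNat_of_nonneg (by have := hlu a ha; omega)]
    ring
  · rintro ⟨a, z⟩ ⟨a', z'⟩ h
    obtain ⟨rfl, rfl⟩ := he _ _ _ _ h
    rfl

/-! ### Recognizing the numerator of the Ehrhart series -/

/-- The series `z^j / (1 - z)^(d + 1)` has coefficients `(d - j + k).choose d`. -/
theorem isHStarPolynomial_of_count {d : ℕ} (hd : 2 ≤ d) (P : Set (Fin d → ℝ)) (a₁ a₂ : ℕ)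
    (h : ∀ k : ℕ, (latticePointCount ((k : ℝ) • P) : ℤ) =
      (d + k).choose d + a₁ * (d - 1 + k).choose d + a₂ * (d - 2 + k).choose d) :
    IsHStarPolynomial P
      (1 + Polynomial.C (a₁ : ℤ) * Polynomial.X + Polynomial.C (a₂ : ℤ) * Polynomial.X ^ 2) := by
  set F : PowerSeries ℤ := PowerSeries.mk fun n => ((d + n).choose d : ℤ) with hF
  have hmul : F * (1 - PowerSeries.X) ^ (d + 1) = 1 :=
    PowerSeries.mk_add_choose_mul_one_sub_pow_eq_one ℤ d
  have hser : ehrhartSeries P =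
      ((1 + Polynomial.C (a₁ : ℤ) * Polynomial.X + Polynomial.C (a₂ : ℤ) * Polynomial.X ^ 2 :
        Polynomial ℤ) : PowerSeries ℤ) * F := by
    ext k
    simp only [Polynomial.coe_add, Polynomial.coe_one, Polynomial.coe_mul, Polynomial.coe_C,
      Polynomial.coe_X, Polynomial.coe_pow, add_mul, one_mul, mul_assoc, map_add,
      PowerSeries.coeff_C_mul, PowerSeries.coeff_X_pow_mul']
    rw [ehrhartSeries, PowerSeries.coeff_mk, h k, hF]
    simp only [PowerSeries.coeff_mk]
    have e1 : (PowerSeries.coeff k) (PowerSeries.X * F) = ((d - 1 + k).choose d : ℤ) := by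
      cases k with
      | zero => simp [Nat.choose_eq_zero_of_lt (show d - 1 < d by omega)]
      | succ k =>
        rw [PowerSeries.coeff_succ_X_mul, hF, PowerSeries.coeff_mk]
        congr 2
        omega
    rw [← hF, e1]
    congr 2
    split_ifs with hk
    · congr 2
      omega
    · exact_mod_cast Nat.choose_eq_zero_of_lt (by omega)
  rw [IsHStarPolynomial, hser, mul_assoc, hmul, mul_one]

theorem two_mul_choose_two (n : ℕ) : 2 * (n.choose 2 : ℤ) = n * (n - 1) := by
  induction n with
  | zero => simp
  | succ n ih =>
    rw [Nat.choose_succ_succ' n 1, Nat.choose_one_right]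
    push_cast
    linarith

theorem six_mul_choose_three (n : ℕ) : 6 * (n.choose 3 : ℤ) = n * (n - 1) * (n - 2) := by
  induction n with
  | zero => simp
  | succ n ih =>
    rw [Nat.choose_succ_succ' n 2]
    push_cast
    linarith [two_mul_choose_two n]

/-! ### A family of polygons -/

/-- The vertices `(0, 0)`, `(p, 0)`, `(m N, 1)`, `(0, N + 1)`. If `p ≤ m (N + 1)`, these are in
convex position (possibly degenerately), and on the heights `0, 1, …, N + 1` the horizontal
widths of their convex hull are `p, m N, m (N - 1), …, 0`. -/
def polygonVertices (p m N : ℕ) : Fin 4 → Fin 2 → ℤ :=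
  ![![0, 0], ![p, 0], ![m * N, 1], ![0, N + 1]]

theorem intVec_mem_smul_polygon (p m N k : ℕ) (v : Fin 2 → ℤ) :
    intVec v ∈ (k : ℝ) • latticeHull (polygonVertices p m N) ↔
      ∃ a b c e : ℝ, 0 ≤ a ∧ 0 ≤ b ∧ 0 ≤ c ∧ 0 ≤ e ∧ a + b + c + e = k ∧
        b * p + c * (m * N) = v 0 ∧ c + e * (N + 1) = v 1 := by
  rw [intVec_mem_smul_latticeHull]
  constructor
  · rintro ⟨c, hc, hs, hv⟩
    refine ⟨c 0, c 1, c 2, c 3, hc 0, hc 1, hc 2, hc 3, ?_, ?_, ?_⟩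
    · rw [← hs, Fin.sum_univ_four]
    · simpa [Fin.sum_univ_four, polygonVertices] using hv 0
    · simpa [Fin.sum_univ_four, polygonVertices] using hv 1
  · rintro ⟨a, b, c, e, ha, hb, hc, he, hs, h0, h1⟩
    refine ⟨![a, b, c, e], ?_, ?_, ?_⟩
    · intro i
      fin_cases i <;> simpa
    · simpa [Fin.sum_univ_four] using hs
    · intro j
      fin_cases j
      · simpa [Fin.sum_univ_four, polygonVertices] using h0
      · simpa [Fin.sum_univ_four, polygonVertices] using h1

/-- The width at height `y` of the `k`-th dilate of the polygon. -/
def polygonWidth (p m N k y : ℕ) : ℤ :=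
  if y ≤ k then k * p + y * (m * N - p) else m * (k * (N + 1) - y)

theorem polygonWidth_nonneg {p m N k y : ℕ} (hy : y ≤ k * (N + 1)) :
    0 ≤ polygonWidth p m N k y := by
  unfold polygonWidth
  split_ifs with h
  · obtain ⟨j, rfl⟩ := Nat.exists_eq_add_of_le h
    have : ((y + j : ℕ) : ℤ) * p + y * (m * N - p) = j * p + y * (m * N) := by push_cast; ring
    rw [this]
    positivity
  · have : (y : ℤ) ≤ k * (N + 1) := by exact_mod_cast hy
    exact mul_nonneg (by positivity) (by linarith)

theorem mem_smul_polygon_iff {p m N : ℕ} (hp : p ≤ m * (N + 1)) (k : ℕ) (v : Fin 2 → ℤ) :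
    intVec v ∈ (k : ℝ) • latticeHull (polygonVertices p m N) ↔
      ∃ y ∈ Finset.range (k * (N + 1) + 1), ∃ x : ℤ,
        0 ≤ x ∧ x ≤ polygonWidth p m N k y ∧ ![x, (y : ℤ)] = v := by
  have hp' : (p : ℝ) ≤ m * (N + 1) := by exact_mod_cast hp
  constructor
  · intro h
    obtain ⟨a, b, c, e, ha, hb, hc, he, hs, h0, h1⟩ := (intVec_mem_smul_polygon p m N k v).1 h
    have hv0 : 0 ≤ v 0 := by
      have : (0 : ℝ) ≤ v 0 := by rw [← h0]; positivity
      exact_mod_cast this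
    have hv1 : 0 ≤ v 1 := by
      have : (0 : ℝ) ≤ v 1 := by rw [← h1]; positivity
      exact_mod_cast this
    obtain ⟨y, hy⟩ := Int.eq_ofNat_of_zero_le hv1
    have h1' : c + e * (N + 1) = (y : ℝ) := by rw [h1, hy]; simp
    refine ⟨y, ?_, v 0, hv0, ?_, ?_⟩
    · have : (y : ℝ) ≤ k * (N + 1) := by
        rw [← h1', ← hs]
        have : 0 ≤ a * (N + 1) + b * (N + 1) + c * N := by positivity
        linarith
      rw [Finset.mem_range, Nat.lt_succ_iff]
      exact_mod_cast this
    · unfold polygonWidth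
      split_ifs
      · have : (v 0 : ℝ) ≤ k * p + y * (m * N - p) := by
          rw [← h0, ← h1', ← hs]
          have h2 : 0 ≤ e * N * (m * (N + 1) - p) :=
            mul_nonneg (by positivity) (by linarith)
          have h3 : 0 ≤ a * p := by positivity
          linarith
        exact_mod_cast this
      · have : (v 0 : ℝ) ≤ m * (k * (N + 1) - y) := by
          rw [← h0, ← h1', ← hs]
          have h2 : 0 ≤ b * (m * (N + 1) - p) := mul_nonneg hb (by linarith)
          have h3 : 0 ≤ a * (m * (N + 1)) := by positivity
          linarith
        exact_mod_cast this
    · ext j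
      fin_cases j <;> simp [hy]
  · rintro ⟨y, hy, x, hx, hxw, rfl⟩
    rw [Finset.mem_range, Nat.lt_succ_iff] at hy
    have hy' : (y : ℝ) ≤ k * (N + 1) := by exact_mod_cast hy
    have hN : (0 : ℝ) < N + 1 := by positivity
    refine ((convex_convexHull ℝ _).smul (k : ℝ)).mem_of_coordinate_between
      (l := ![0, (y : ℤ)]) (u := ![polygonWidth p m N k y, (y : ℤ)]) ?_ ?_ 0 hx hxw ?_
    · refine (intVec_mem_smul_polygon p m N k _).2
        ⟨k - y / (N + 1), 0, 0, y / (N + 1), ?_, le_rfl, le_rfl, by positivity, ?_, ?_, ?_⟩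
      · rw [sub_nonneg, div_le_iff₀ hN]
        exact hy'
      · ring
      · simp
      · simp only [Matrix.cons_val_one, Matrix.cons_val_fin_one, Int.cast_natCast]
        field_simp
        ring
    · by_cases h : y ≤ k
      · have h' : (y : ℝ) ≤ k := by exact_mod_cast h
        refine (intVec_mem_smul_polygon p m N k _).2
          ⟨0, k - y, y, 0, le_rfl, by linarith, by positivity, le_rfl, by ring, ?_, ?_⟩
        · simp only [polygonWidth, if_pos h, Matrix.cons_val_zero]
          push_cast
          ring
        · simp
      · have hN0 : (0 : ℝ) < N := by
          rcases Nat.eq_zero_or_pos N with rfl | hN0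
          · omega
          · exact_mod_cast hN0
        have h' : (k : ℝ) ≤ y := by
          push Not at h
          exact_mod_cast h.le
        refine (intVec_mem_smul_polygon p m N k _).2
          ⟨0, 0, (k * (N + 1) - y) / N, (y - k) / N, le_rfl, le_rfl,
            div_nonneg (by linarith) hN0.le, div_nonneg (by linarith) hN0.le, ?_, ?_, ?_⟩
        · field_simp
          ring
        · simp only [polygonWidth, if_neg h, Matrix.cons_val_zero]
          push_cast
          field_simp
          ring
        · simp only [Matrix.cons_val_one, Matrix.cons_val_fin_one, Int.cast_natCast]
          field_simp
          ring
    · intro j hj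
      fin_cases j
      · exact absurd rfl hj
      · simp

theorem two_mul_latticePointCount_polygon {p m N : ℕ} (hp : p ≤ m * (N + 1)) (k : ℕ) :
    2 * (latticePointCount ((k : ℝ) • latticeHull (polygonVertices p m N)) : ℤ) =
      k * (p + m * N) * (k + 1) + 2 * (k + 1) + m * (k * N) * (k * N - 1) + 2 * (k * N) := by
  rw [latticePointCount, ncard_eq_sum_fibres
    {v | intVec v ∈ (k : ℝ) • latticeHull (polygonVertices p m N)} _ (fun _ => 0) (polygonWidth p m N k)
    (fun y x => ![x, (y : ℤ)]) ?_ (mem_smul_polygon_iff hp k)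
    (fun y hy => polygonWidth_nonneg (by rw [Finset.mem_range] at hy; omega))]
  · rw [show k * (N + 1) + 1 = (k + 1) + k * N by ring, Finset.sum_range_add]
    have lower : ∑ y ∈ Finset.range (k + 1), (polygonWidth p m N k y - 0 + 1) =
        ∑ y ∈ Finset.range (k + 1), ((k : ℤ) * p + y * (m * N - p) + 1) := by
      refine Finset.sum_congr rfl fun y hy => ?_
      rw [polygonWidth, if_pos (by rw [Finset.mem_range] at hy; omega), sub_zero]
    have upper : ∑ y ∈ Finset.range (k * N), (polygonWidth p m N k (k + 1 + y) - 0 + 1) =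
        ∑ y ∈ Finset.range (k * N), ((m : ℤ) * (k * N - 1 - y) + 1) := by
      refine Finset.sum_congr rfl fun y _ => ?_
      rw [polygonWidth, if_neg (by omega)]
      push_cast
      ring
    have lower_sum : ∀ n : ℕ,
        2 * ∑ y ∈ Finset.range n, ((k : ℤ) * p + y * (m * N - p) + 1) =
          2 * n * (k * p + 1) + n * (n - 1) * (m * N - p) := by
      intro n
      induction n with
      | zero => simp
      | succ n ih => rw [Finset.sum_range_succ, mul_add, ih]; push_cast; ring
    have upper_sum : ∀ n : ℕ,
        2 * ∑ y ∈ Finset.range n, ((m : ℤ) * (k * N - 1 - y) + 1) =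
          m * n * (2 * (k * N) - 1 - n) + 2 * n := by
      intro n
      induction n with
      | zero => simp
      | succ n ih => rw [Finset.sum_range_succ, mul_add, ih]; push_cast; ring
    rw [lower, upper, mul_add, lower_sum, upper_sum]
    push_cast
    ring
  · intro y y' x x' h
    have h0 := congrFun h 0
    have h1 := congrFun h 1
    simp only [Matrix.cons_val_zero, Matrix.cons_val_one, Matrix.cons_val_fin_one] at h0 h1
    exact ⟨by exact_mod_cast h1, h0⟩

theorem isLatticePolytope_polygon {p m N : ℕ} (h : 0 < p ∨ 0 < m * N) :
    IsLatticePolytope (latticeHull (polygonVertices p m N)) := by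
  set W := Submodule.span ℝ (Set.range fun i => intVec (polygonVertices p m N i))
  have hmem : ∀ i, intVec (polygonVertices p m N i) ∈ W := fun i => Submodule.subset_span ⟨i, rfl⟩
  have hN : ((N : ℝ) + 1) ≠ 0 := by positivity
  have e₁ : Pi.single 1 (1 : ℝ) ∈ W := by
    have := W.smul_mem ((N : ℝ) + 1)⁻¹ (hmem 3)
    convert this using 1
    ext j
    fin_cases j <;> simp [intVec, polygonVertices, hN]
  have e₀ : Pi.single 0 (1 : ℝ) ∈ W := by
    rcases h with h | h
    · have hp : (p : ℝ) ≠ 0 := by positivity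
      have := W.smul_mem (p : ℝ)⁻¹ (hmem 1)
      convert this using 1
      ext j
      fin_cases j <;> simp [intVec, polygonVertices, hp]
    · have hp : (m * N : ℝ) ≠ 0 := by exact_mod_cast h.ne'
      have := W.smul_mem (m * N : ℝ)⁻¹ (W.sub_mem (hmem 2) e₁)
      convert this using 1
      ext j
      fin_cases j
      · simp [-mul_inv_rev, intVec, polygonVertices, hp]
      · simp [intVec, polygonVertices]
  refine isLatticePolytope_latticeHull _ 0 ?_ fun j => ?_
  · ext j
    fin_cases j <;> simp [polygonVertices]
  · fin_cases j
    · exact e₀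
    · exact e₁

theorem isHStarPolynomial_polygon {p m N a₁ a₂ : ℕ} (hp : p ≤ m * (N + 1))
    (h : ∀ k : ℤ, k * (p + m * N) * (k + 1) + 2 * (k + 1) + m * (k * N) * (k * N - 1) +
      2 * (k * N) = (k + 2) * (k + 1) + a₁ * ((k + 1) * k) + a₂ * (k * (k - 1))) :
    IsHStarPolynomial (latticeHull (polygonVertices p m N))
      (1 + Polynomial.C (a₁ : ℤ) * Polynomial.X + Polynomial.C (a₂ : ℤ) * Polynomial.X ^ 2) := by
  refine isHStarPolynomial_of_count le_rfl _ _ _ fun k => ?_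
  have h₁ := two_mul_latticePointCount_polygon hp k
  rw [h k] at h₁
  refine mul_left_cancel₀ (two_ne_zero (α := ℤ)) ?_
  have c₂ := two_mul_choose_two (2 + k)
  have c₁ := two_mul_choose_two (2 - 1 + k)
  have c₀ := two_mul_choose_two (2 - 2 + k)
  push_cast at c₀ c₁ c₂
  rw [h₁]
  linear_combination -c₂ - a₁ * c₁ - a₂ * c₀

/-! ### A family of three-dimensional polytopes over the unit square -/

/-- The vertices `0`, `(0, 0, -a)`, `e₁`, `e₂`, `(1, 1, K)`. Their convex hull projects onto the
unit square, and for `a ≤ K` its fibre over `(x, y)` is bounded above by `K min(x, y)` and below by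
`a (x + y - 1)` or `K (x + y - 1)`, according to the sign of `x + y - 1`. -/
def squareVertices (a K : ℕ) : Fin 5 → Fin 3 → ℤ :=
  ![![0, 0, 0], ![0, 0, -a], ![1, 0, 0], ![0, 1, 0], ![1, 1, K]]

theorem intVec_mem_smul_square (a K k : ℕ) (v : Fin 3 → ℤ) :
    intVec v ∈ (k : ℝ) • latticeHull (squareVertices a K) ↔
      ∃ o s x y t : ℝ, 0 ≤ o ∧ 0 ≤ s ∧ 0 ≤ x ∧ 0 ≤ y ∧ 0 ≤ t ∧ o + s + x + y + t = k ∧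
        x + t = v 0 ∧ y + t = v 1 ∧ t * K - s * a = v 2 := by
  rw [intVec_mem_smul_latticeHull]
  constructor
  · rintro ⟨c, hc, hs, hv⟩
    refine ⟨c 0, c 1, c 2, c 3, c 4, hc 0, hc 1, hc 2, hc 3, hc 4, ?_, ?_, ?_, ?_⟩
    · rw [← hs, Fin.sum_univ_five]
    · simpa [Fin.sum_univ_five, squareVertices] using hv 0
    · simpa [Fin.sum_univ_five, squareVertices] using hv 1
    · rw [← hv 2]
      simp [Fin.sum_univ_five, squareVertices]
      ring
  · rintro ⟨o, s, x, y, t, ho, hs, hx, hy, ht, hk, h0, h1, h2⟩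
    refine ⟨![o, s, x, y, t], ?_, ?_, ?_⟩
    · intro i
      fin_cases i <;> simpa
    · simpa [Fin.sum_univ_five] using hk
    · intro j
      fin_cases j
      · simpa [Fin.sum_univ_five, squareVertices] using h0
      · simpa [Fin.sum_univ_five, squareVertices] using h1
      · simp only [Fin.reduceFinMk, ← h2]
        simp [Fin.sum_univ_five, squareVertices]
        ring

/-- The lower end of the fibre over `(x, y)` of the `k`-th dilate. -/
def squareLower (a K k : ℕ) (b : ℕ × ℕ) : ℤ :=
  if b.1 + b.2 ≤ k then a * (b.1 + b.2 - k) else K * (b.1 + b.2 - k)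

/-- The upper end of the fibre over `(x, y)` of the dilates that contain `(x, y)` in their
projection. -/
def squareUpper (K : ℕ) (b : ℕ × ℕ) : ℤ := K * (min b.1 b.2 : ℕ)

theorem squareLower_le_squareUpper {a K k : ℕ} {b : ℕ × ℕ} (h₁ : b.1 ≤ k) (h₂ : b.2 ≤ k) :
    squareLower a K k b ≤ squareUpper K b := by
  unfold squareLower squareUpper
  split_ifs with h
  · have h' : ((b.1 : ℤ) + b.2 - k) ≤ 0 := by omega
    exact (mul_nonpos_of_nonneg_of_nonpos (by positivity) h').trans (by positivity)
  · exact mul_le_mul_of_nonneg_left (by omega) (by positivity)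

theorem mem_smul_square_iff {a K : ℕ} (ha : a ≤ K) (k : ℕ) (v : Fin 3 → ℤ) :
    intVec v ∈ (k : ℝ) • latticeHull (squareVertices a K) ↔
      ∃ b ∈ Finset.range (k + 1) ×ˢ Finset.range (k + 1), ∃ z : ℤ,
        squareLower a K k b ≤ z ∧ z ≤ squareUpper K b ∧ ![(b.1 : ℤ), (b.2 : ℤ), z] = v := by
  have ha' : (a : ℝ) ≤ K := by exact_mod_cast ha
  constructor
  · intro h
    obtain ⟨o, s, p, q, t, ho, hs, hp, hq, ht, hk, h0, h1, h2⟩ :=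
      (intVec_mem_smul_square a K k v).1 h
    have hv0 : 0 ≤ v 0 := by
      have : (0 : ℝ) ≤ v 0 := by rw [← h0]; positivity
      exact_mod_cast this
    have hv1 : 0 ≤ v 1 := by
      have : (0 : ℝ) ≤ v 1 := by rw [← h1]; positivity
      exact_mod_cast this
    obtain ⟨x, hx⟩ := Int.eq_ofNat_of_zero_le hv0
    obtain ⟨y, hy⟩ := Int.eq_ofNat_of_zero_le hv1
    have h0' : p + t = (x : ℝ) := by rw [h0, hx]; simp
    have h1' : q + t = (y : ℝ) := by rw [h1, hy]; simp
    have hsK : s * a ≤ s * K := mul_le_mul_of_nonneg_left ha' hs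
    have hsa : 0 ≤ s * a := by positivity
    refine ⟨(x, y), ?_, v 2, ?_, ?_, ?_⟩
    · have hxk : (x : ℝ) ≤ k := by linarith
      have hyk : (y : ℝ) ≤ k := by linarith
      rw [Finset.mem_product, Finset.mem_range, Finset.mem_range, Nat.lt_succ_iff, Nat.lt_succ_iff]
      exact ⟨by exact_mod_cast hxk, by exact_mod_cast hyk⟩
    · unfold squareLower
      split_ifs
      · have : (a * (x + y - k) : ℝ) ≤ v 2 := by
          rw [← h2, ← h0', ← h1', ← hk]
          have h3 : t * a ≤ t * K := mul_le_mul_of_nonneg_left ha' ht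
          have h4 : 0 ≤ o * a := by positivity
          linarith
        exact_mod_cast this
      · have : (K * (x + y - k) : ℝ) ≤ v 2 := by
          rw [← h2, ← h0', ← h1', ← hk]
          have h4 : 0 ≤ o * K := by positivity
          linarith
        exact_mod_cast this
    · have hle : ∀ n : ℕ, t ≤ n → v 2 ≤ (K * n : ℤ) := fun n hn => by
        have : (v 2 : ℝ) ≤ K * n := by
          rw [← h2]
          have := mul_le_mul_of_nonneg_right hn (Nat.cast_nonneg (α := ℝ) K)
          linarith
        exact_mod_cast this
      refine hle _ ?_
      rw [Nat.cast_min]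
      exact le_min (by linarith) (by linarith)
    · ext j
      fin_cases j <;> simp [hx, hy]
  · rintro ⟨⟨x, y⟩, hb, z, hl, hu, rfl⟩
    rw [Finset.mem_product, Finset.mem_range, Finset.mem_range, Nat.lt_succ_iff,
      Nat.lt_succ_iff] at hb
    obtain ⟨hxk, hyk⟩ := hb
    dsimp only at hxk hyk
    have hxk' : (x : ℝ) ≤ k := by exact_mod_cast hxk
    have hyk' : (y : ℝ) ≤ k := by exact_mod_cast hyk
    have hx0 : (0 : ℝ) ≤ x := x.cast_nonneg
    have hy0 : (0 : ℝ) ≤ y := y.cast_nonneg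
    refine ((convex_convexHull ℝ _).smul (k : ℝ)).mem_of_coordinate_between
      (l := ![(x : ℤ), (y : ℤ), squareLower a K k (x, y)])
      (u := ![(x : ℤ), (y : ℤ), squareUpper K (x, y)]) ?_ ?_ 2 hl hu ?_
    · by_cases h : x + y ≤ k
      · have h' : (x + y : ℝ) ≤ k := by exact_mod_cast h
        refine (intVec_mem_smul_square a K k _).2
          ⟨0, k - x - y, x, y, 0, le_rfl, by linarith, hx0, hy0, le_rfl, by ring, ?_, ?_, ?_⟩
        · simp
        · simp
        · simp [squareLower, h]
          ring
      · have h' : (k : ℝ) ≤ x + y := by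
          push Not at h
          exact_mod_cast h.le
        refine (intVec_mem_smul_square a K k _).2
          ⟨0, 0, k - y, k - x, x + y - k, le_rfl, le_rfl, by linarith, by linarith, by linarith,
            by ring, ?_, ?_, ?_⟩
        · simp
        · simp
        · simp [squareLower, h]
          ring
    · refine (intVec_mem_smul_square a K k _).2
        ⟨k - max (x : ℝ) y, 0, x - min (x : ℝ) y, y - min (x : ℝ) y, min (x : ℝ) y, ?_, le_rfl, ?_, ?_,
          le_min hx0 hy0, ?_, ?_, ?_, ?_⟩
      · exact sub_nonneg.2 (max_le hxk' hyk')
      · exact sub_nonneg.2 (min_le_left _ _)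
      · exact sub_nonneg.2 (min_le_right _ _)
      · linarith [min_add_max (x : ℝ) y]
      · simp
      · simp
      · simp [squareUpper]
        ring
    · intro j hj
      fin_cases j
      · simp
      · simp
      · exact absurd rfl hj

theorem two_mul_sum_range_min (x j : ℕ) :
    2 * ∑ y ∈ Finset.range (x + j + 1), ((min x y : ℕ) : ℤ) = x * (x + 1) + 2 * x * j := by
  induction j with
  | zero =>
    have h : ∑ y ∈ Finset.range (x + 1), ((min x y : ℕ) : ℤ) =
        ((∑ y ∈ Finset.range (x + 1), y : ℕ) : ℤ) := by
      push_cast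
      refine Finset.sum_congr rfl fun y hy => ?_
      rw [Finset.mem_range] at hy
      rw [min_eq_right (by exact_mod_cast Nat.lt_succ_iff.1 hy)]
    have := Finset.sum_range_id_mul_two (x + 1)
    rw [add_zero, h]
    zify at this
    simp at this ⊢
    linarith
  | succ j ih =>
    rw [← add_assoc, Finset.sum_range_succ, mul_add, ih, min_eq_left (by omega)]
    push_cast
    ring

theorem two_mul_sum_range_sub (x j : ℕ) :
    2 * ∑ y ∈ Finset.range (x + j + 1), ((j - y : ℕ) : ℤ) = j * (j + 1) := by
  induction x with
  | zero =>
    have h := Finset.sum_range_reflect (fun y => y) (j + 1)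
    have h' := Finset.sum_range_id_mul_two (j + 1)
    rw [← h] at h'
    zify at h'
    simp at h' ⊢
    linarith
  | succ x ih =>
    rw [show x + 1 + j + 1 = (x + j + 1) + 1 by ring, Finset.sum_range_succ, mul_add, ih,
      Nat.sub_eq_zero_of_le (by omega)]
    simp

theorem two_mul_sum_range_sub' (x j : ℕ) :
    2 * ∑ y ∈ Finset.range (x + j + 1), ((y - j : ℕ) : ℤ) = x * (x + 1) := by
  induction x with
  | zero =>
    rw [Finset.sum_eq_zero]
    · simp
    · intro y hy
      rw [Finset.mem_range] at hy
      rw [Nat.sub_eq_zero_of_le (by omega), Nat.cast_zero]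
  | succ x ih =>
    rw [show x + 1 + j + 1 = (x + j + 1) + 1 by ring, Finset.sum_range_succ, mul_add, ih,
      show x + j + 1 - j = x + 1 by omega]
    push_cast
    ring

theorem two_mul_sum_fibre_square (a K : ℕ) {k x : ℕ} (hx : x ≤ k) :
    2 * ∑ y ∈ Finset.range (k + 1), (squareUpper K (x, y) - squareLower a K k (x, y) + 1) =
      2 * K * (x * (k - x)) + a * ((k - x) * (k - x + 1)) + 2 * (k + 1) := by
  obtain ⟨j, rfl⟩ := Nat.exists_eq_add_of_le hx
  have h : ∀ y, squareUpper K (x, y) - squareLower a K (x + j) (x, y) + 1 =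
      K * ((min x y : ℕ) : ℤ) + a * ((j - y : ℕ) : ℤ) - K * ((y - j : ℕ) : ℤ) + 1 := by
    intro y
    unfold squareUpper squareLower
    split_ifs with hy
    · rw [Nat.sub_eq_zero_of_le (show y ≤ j by omega), Nat.cast_sub (show y ≤ j by omega)]
      push_cast
      ring
    · rw [Nat.sub_eq_zero_of_le (show j ≤ y by omega), Nat.cast_sub (show j ≤ y by omega)]
      push_cast
      ring
  rw [Finset.sum_congr rfl fun y _ => h y, Finset.sum_add_distrib, Finset.sum_sub_distrib,
    Finset.sum_add_distrib, ← Finset.mul_sum, ← Finset.mul_sum, ← Finset.mul_sum]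
  simp only [Finset.sum_const, Finset.card_range, nsmul_eq_mul, mul_one, Nat.cast_add,
    Nat.cast_one]
  linear_combination K * two_mul_sum_range_min x j + a * two_mul_sum_range_sub x j
    - K * two_mul_sum_range_sub' x j

theorem six_mul_latticePointCount_square {a K : ℕ} (ha : a ≤ K) (k : ℕ) :
    6 * (latticePointCount ((k : ℝ) • latticeHull (squareVertices a K)) : ℤ) =
      K * ((k + 1) * k * (k - 1)) + a * ((k + 2) * (k + 1) * k) + 6 * (k + 1) ^ 2 := by
  rw [latticePointCount, ncard_eq_sum_fibres
    {v | intVec v ∈ (k : ℝ) • latticeHull (squareVertices a K)} _ (squareLower a K k) (squareUpper K)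
    (fun b z => ![(b.1 : ℤ), (b.2 : ℤ), z]) ?_ (mem_smul_square_iff ha k) ?_]
  · have key : ∀ n : ℕ, 3 * ∑ x ∈ Finset.range n,
        (2 * K * ((x : ℤ) * (k - x)) + a * ((k - x) * (k - x + 1)) + 2 * (k + 1)) =
          K * (n * (n - 1) * (3 * k - 2 * n + 1)) +
            a * (k * (k + 1) * (k + 2) - (k - n) * (k - n + 1) * (k - n + 2)) +
              6 * n * (k + 1) := by
      intro n
      induction n with
      | zero => simp
      | succ n ih => rw [Finset.sum_range_succ, mul_add, ih]; push_cast; ring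
    rw [Finset.sum_product, show (6 : ℤ) = 3 * 2 by norm_num, mul_assoc, Finset.mul_sum,
      Finset.sum_congr rfl fun x hx =>
        two_mul_sum_fibre_square a K (Nat.lt_succ_iff.1 (Finset.mem_range.1 hx)), key]
    push_cast
    ring
  · rintro ⟨x, y⟩ ⟨x', y'⟩ z z' h
    have h0 := congrFun h 0
    have h1 := congrFun h 1
    have h2 := congrFun h 2
    simp at h0 h1 h2
    simp [h0, h1, h2]
  · intro b hb
    rw [Finset.mem_product, Finset.mem_range, Finset.mem_range, Nat.lt_succ_iff,
      Nat.lt_succ_iff] at hb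
    exact squareLower_le_squareUpper hb.1 hb.2

theorem isLatticePolytope_square {a K : ℕ} (hK : 0 < K) :
    IsLatticePolytope (latticeHull (squareVertices a K)) := by
  set W := Submodule.span ℝ (Set.range fun i => intVec (squareVertices a K i))
  have hmem : ∀ i, intVec (squareVertices a K i) ∈ W := fun i => Submodule.subset_span ⟨i, rfl⟩
  have hK' : (K : ℝ) ≠ 0 := by positivity
  refine isLatticePolytope_latticeHull _ 0 ?_ fun j => ?_
  · ext j
    fin_cases j <;> simp [squareVertices]
  · fin_cases j
    · convert hmem 2 using 1
      ext i
      fin_cases i <;> simp [intVec, squareVertices]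
    · convert hmem 3 using 1
      ext i
      fin_cases i <;> simp [intVec, squareVertices]
    · convert W.smul_mem (K : ℝ)⁻¹ (W.sub_mem (W.sub_mem (hmem 4) (hmem 2)) (hmem 3)) using 1
      ext i
      fin_cases i <;> simp [intVec, squareVertices, hK']

theorem isHStarPolynomial_square {a₁ a₂ : ℕ} (h : a₁ ≤ a₂ + 1) :
    IsHStarPolynomial (latticeHull (squareVertices a₁ (a₂ + 1)))
      (1 + Polynomial.C (a₁ : ℤ) * Polynomial.X + Polynomial.C (a₂ : ℤ) * Polynomial.X ^ 2) := by
  refine isHStarPolynomial_of_count (by norm_num) _ _ _ fun k => ?_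
  refine mul_left_cancel₀ (show (6 : ℤ) ≠ 0 by norm_num) ?_
  have c₂ := six_mul_choose_three (3 + k)
  have c₁ := six_mul_choose_three (3 - 1 + k)
  have c₀ := six_mul_choose_three (3 - 2 + k)
  rw [six_mul_latticePointCount_square h]
  push_cast at c₀ c₁ c₂ ⊢
  linear_combination -c₂ - a₁ * c₁ - a₂ * c₀

/-! ### Realizing the prescribed coefficients -/

theorem proposition1p10 (a₁ a₂ : ℕ)
    (h₁ : a₂ = 1 → a₁ ≤ 7) (h₂ : 2 ≤ a₂ → a₁ ≤ 3 * a₂ + 3) :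
    ∃ (d : ℕ) (P : Set (Fin d → ℝ)), IsLatticePolytope P ∧
      IsHStarPolynomial P
        (1 + Polynomial.C (a₁ : ℤ) * Polynomial.X + Polynomial.C (a₂ : ℤ) * Polynomial.X ^ 2) := by
  by_cases hle : a₁ ≤ a₂
  · exact ⟨3, _, isLatticePolytope_square a₂.succ_pos, isHStarPolynomial_square (by omega)⟩
  rcases Nat.eq_zero_or_pos a₂ with rfl | hpos
  · -- the triangle with vertices `(0, 0)`, `(a₁ + 1, 0)`, `(0, 1)`
    refine ⟨2, _, isLatticePolytope_polygon (p := a₁ + 1) (m := a₁ + 1) (N := 0)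
      (Or.inl (by omega)), isHStarPolynomial_polygon (by omega) fun k => ?_⟩
    push_cast
    ring
  by_cases h7 : a₂ = 1 ∧ a₁ = 7
  · -- the triangle with vertices `(0, 0)`, `(3, 0)`, `(0, 3)`, in which `(2, 1)` lies on an edge
    obtain ⟨rfl, rfl⟩ := h7
    refine ⟨2, _, isLatticePolytope_polygon (p := 3) (m := 1) (N := 2)
      (Or.inl (by omega)), isHStarPolynomial_polygon (by omega) fun k => ?_⟩
    push_cast
    ring
  · -- a polygon between the heights `0` and `2`, with `a₂` interior points, all at height `1`
    obtain ⟨p, rfl⟩ := Nat.exists_eq_add_of_le (show a₂ + 1 ≤ a₁ by omega)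
    refine ⟨2, _, isLatticePolytope_polygon (p := p) (m := a₂ + 1) (N := 1)
      (Or.inr (by omega)), isHStarPolynomial_polygon (by omega) fun k => ?_⟩
    push_cast
    ring
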